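/- Let $d\ge 0$ and $k\ge 2$ be integers, and let $X\subset[0,1]^d$ be a non-empty compact set. For an integer $a\ge 0$ and $\mathbf b=(b_1,\dots,b_d)\in\mathbb Z^d$ with $0\le b_i<k^a$ for all $i$, put $$\mathcal K_{a,\mathbf b}=\Big\{(k^ax_1-b_1,\dots,k^ax_d-b_d)\ :\ (x_1,\dots,x_d)\in X\cap\prod_{i=1}^d\Big[\frac{b_i}{k^a},\frac{b_i+1}{k^a}\Big]\Big\}.$$ Suppose that $X$ is $k$-self-similar, i.e. that the collection of all the sets $\mathcal K_{a,\mathbf b}$ (the $k$-kernel of $X$) is finite. Let $\mathcal L_X$ be the set of all finite words over the alphabet $\{0,\dots,k-1\}^d$ that occur as blocks of consecutive letters $\mathbf b^{(m+1)}\mathbf b^{(m+2)}\cdots\mathbf b^{(m+p)}$ $(m,p\ge 0)$ of some infinite word $\mathbf b^{(1)}\mathbf b^{(2)}\mathbf b^{(3)}\cdots$ over this alphabet for which the point $\sum_{j\ge 1}k^{-j}\mathbf b^{(j)}$ belongs to $X$ (thus all $k$-adic expansions of all points of $X$ are used, including both expansions of coordinates that are $k$-adic rationals in $(0,1)$). Let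 $\mathcal P(\mathcal L_X,n)$ be the number of words of length $n$ in $\mathcal L_X$. Then the limit $$h(X)=\lim_{n\to\infty}\frac1n\log_k\mathcal P(\mathcal L_X,n)$$ (the entropy of $X$) exists, is finite and non-negative, and equals the Hausdorff dimension of $X$: $$\dim_{\mathcal H}(X)=h(X).$$ -/

import Mathlib

open Filter Topology

/-- The unit cube `[0,1]^d` in Euclidean space `ℝ^d`. -/
def unitCube (d : ℕ) : Set (EuclideanSpace ℝ (Fin d)) :=
  {x | ∀ i, 0 ≤ x i ∧ x i ≤ 1}

/-- The piece of `X` in the closed grid cube `∏ i, [b i / k^a, (b i + 1) / k^a]`, scaled back up to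
the unit cube: all points `(k^a x_1 - b_1, …, k^a x_d - b_d)` with `x` in that piece. -/
def kernelPiece {d : ℕ} (k : ℕ) (X : Set (EuclideanSpace ℝ (Fin d))) (a : ℕ) (b : Fin d → ℕ) :
    Set (EuclideanSpace ℝ (Fin d)) :=
  {y | ∃ x ∈ X, (∀ i, (b i : ℝ) / (k : ℝ) ^ a ≤ x i ∧ x i ≤ ((b i : ℝ) + 1) / (k : ℝ) ^ a) ∧
    ∀ i, y i = (k : ℝ) ^ a * x i - (b i : ℝ)}

/-- The `k`-kernel of `X`: the collection of all rescaled pieces of `X` in grid cubes of side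
`k^(-a)` contained in the unit cube, over all levels `a ≥ 0`. -/
def kKernel {d : ℕ} (k : ℕ) (X : Set (EuclideanSpace ℝ (Fin d))) :
    Set (Set (EuclideanSpace ℝ (Fin d))) :=
  {K | ∃ (a : ℕ) (b : Fin d → ℕ), (∀ i, b i < k ^ a) ∧ K = kernelPiece k X a b}

/-- `X ⊆ [0,1]^d` is `k`-self-similar: it is compact and its `k`-kernel is finite. -/
structure IsSelfSimilar {d : ℕ} (k : ℕ) (X : Set (EuclideanSpace ℝ (Fin d))) : Prop where
  subset_unitCube : X ⊆ unitCube d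
  isCompact : IsCompact X
  finite_kKernel : (kKernel k X).Finite

/-- The infinite word `w`, over the alphabet of `d`-tuples of base-`k` digits, is a `k`-adic
expansion of `x`: for each coordinate `i`, `x i = ∑ j, (w j i) / k^(j+1)`. A point may have
several expansions. -/
def IsExpansion {d k : ℕ} (w : ℕ → Fin d → Fin k) (x : EuclideanSpace ℝ (Fin d)) : Prop :=
  ∀ i, x i = Real.ofDigits (fun j => w j i)

/-- The language of `X`: all finite subwords (blocks of `p` consecutive letters, starting after the
first `m` letters) of all `k`-adic expansions of all points of `X`. -/
def digitLanguage {d : ℕ} (k : ℕ) (X : Set (EuclideanSpace ℝ (Fin d))) :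
    Language (Fin d → Fin k) :=
  {u | ∃ x ∈ X, ∃ w : ℕ → Fin d → Fin k, IsExpansion w x ∧
    ∃ m p : ℕ, u = List.ofFn (fun j : Fin p => w (m + j))}

/-- The number of words of length `n` in the language `L`. -/
noncomputable def wordCount {A : Type*} (L : Language A) (n : ℕ) : ℕ :=
  Set.ncard {u : List A | u ∈ L ∧ u.length = n}

/-- `h` is the (base `k`) entropy of `X`: the limit of `(1/n) log_k P(n)` exists and equals `h`,
where `P(n)` is the number of words of length `n` in the language of `X`. -/
def HasEntropy {d : ℕ} (k : ℕ) (X : Set (EuclideanSpace ℝ (Fin d))) (h : ℝ) : Prop :=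
  Tendsto (fun n : ℕ => (1 / (n : ℝ)) * Real.logb (k : ℝ) (wordCount (digitLanguage k X) n : ℝ))
    atTop (𝓝 h)

/-! Let `S` be the set of all expansions of points of `X`, a closed set of infinite words. The word
sets that may follow a prefix `u` in `S` are exactly the sets of expansions of kernel pieces, so
self-similarity says that `S` has finitely many follower sets. Counting factors of `S` is
submultiplicative, so Fekete's lemma gives the entropy `h`.

For `dimH X ≤ h`, cover `X` by the images of the cylinders of its factors of length `n`, which have
diameter `O(k ^ (-n))`.

For `h ≤ dimH X`, take `s > dimH X`. Every kernel piece is null for the `s`-dimensional Hausdorff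
measure, so each follower set has a cover of small `s`-weight, which `exists_finset_cylinders` turns
into finitely many cylinders of total weight `< 1`, using compactness and the fact that a small set
meets boundedly many grid cubes. Iterating these covers (`exists_ncard_prefixes_le`) bounds the
number of prefixes of length `n` by `C * (k ^ s) ^ n`, uniformly over follower sets. Every factor is
a prefix of an element of some follower set, whence `h ≤ s`. -/

/-- The infinite word obtained by putting the finite word `u` in front of `w`. -/
def prependWord {A : Type*} : List A → (ℕ → A) → ℕ → A
  | [], w => w
  | a :: u, w => fun n => Nat.casesOn n a (prependWord u w)

/-- The prefix of length `n` of the infinite word `w`. -/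
def takeWord {A : Type*} (n : ℕ) (w : ℕ → A) : List A :=
  List.ofFn fun j : Fin n => w j

/-- The infinite words that may follow the finite word `u` in `S`. -/
def followers {A : Type*} (S : Set (ℕ → A)) (u : List A) : Set (ℕ → A) :=
  {w | prependWord u w ∈ S}

/-! ### Combinatorics of infinite words: prefixes, follower sets, factors -/

section Words

variable {A : Type*}

@[simp]
theorem prependWord_nil (w : ℕ → A) : prependWord [] w = w := rfl

@[simp]
theorem prependWord_cons_zero (a : A) (u : List A) (w : ℕ → A) :
    prependWord (a :: u) w 0 = a := rfl

@[simp]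
theorem prependWord_cons_succ (a : A) (u : List A) (w : ℕ → A) (n : ℕ) :
    prependWord (a :: u) w (n + 1) = prependWord u w n := rfl

theorem prependWord_append (u v : List A) (w : ℕ → A) :
    prependWord (u ++ v) w = prependWord u (prependWord v w) := by
  induction u with
  | nil => rfl
  | cons a u ih =>
    funext n
    cases n with
    | zero => rfl
    | succ n => simp [ih]

@[simp]
theorem length_takeWord (n : ℕ) (w : ℕ → A) : (takeWord n w).length = n := by
  simp [takeWord]

theorem takeWord_succ (n : ℕ) (w : ℕ → A) :
    takeWord (n + 1) w = w 0 :: takeWord n fun j => w (j + 1) := by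
  simp [takeWord, List.ofFn_succ]

theorem takeWord_add (m n : ℕ) (w : ℕ → A) :
    takeWord (m + n) w = takeWord m w ++ takeWord n fun j => w (m + j) := by
  simp [takeWord, List.ofFn_add]

theorem prependWord_takeWord (n : ℕ) (w : ℕ → A) :
    prependWord (takeWord n w) (fun j => w (n + j)) = w := by
  induction n generalizing w with
  | zero => simp [takeWord]
  | succ n ih =>
    funext j
    rw [takeWord_succ]
    cases j with
    | zero => rfl
    | succ j =>
      rw [prependWord_cons_succ]
      have := congrFun (ih fun j => w (j + 1)) j
      simpa [add_right_comm] using this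

theorem followers_append (S : Set (ℕ → A)) (u v : List A) :
    followers S (u ++ v) = {w | prependWord v w ∈ followers S u} := by
  ext w
  simp [followers, prependWord_append]

theorem shift_mem_followers {S : Set (ℕ → A)} {w : ℕ → A} (hw : w ∈ S) (m : ℕ) :
    (fun j => w (m + j)) ∈ followers S (takeWord m w) := by
  simpa [followers, prependWord_takeWord] using hw

theorem continuous_prependWord [TopologicalSpace A] (u : List A) :
    Continuous (prependWord u : (ℕ → A) → ℕ → A) := by
  induction u with
  | nil => exact continuous_id
  | cons a u ih =>
    refine continuous_pi fun n => ?_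
    cases n with
    | zero => exact continuous_const
    | succ n => exact (continuous_apply n).comp ih

theorem isOpen_takeWord_eq [TopologicalSpace A] [DiscreteTopology A] (n : ℕ) (u : List A) :
    IsOpen {w : ℕ → A | takeWord n w = u} := by
  have hc : Continuous fun (w : ℕ → A) (j : Fin n) => w j := by fun_prop
  exact (isOpen_discrete {f : Fin n → A | List.ofFn f = u}).preimage hc

theorem finite_image_takeWord [Finite A] (n : ℕ) (F : Set (ℕ → A)) :
    (takeWord n '' F).Finite := by
  refine (List.finite_length_eq A n).subset ?_
  rintro _ ⟨w, -, rfl⟩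
  simp

/-- If each follower set of `S` is covered by finitely many cylinders of total weight `< 1`, the
cylinder of a word of length `n` having weight `q ^ (-n)`, and if there are finitely many follower
sets, then the number of prefixes of length `n` is `O(q ^ n)`. -/
theorem exists_ncard_prefixes_le [Finite A] {S : Set (ℕ → A)}
    (hfin : (Set.range (followers S)).Finite) {q : ℝ} (hq : 1 ≤ q)
    (hcov : ∀ u, ∃ W : Finset (List A),
      (∀ w ∈ followers S u, ∃ v ∈ W, takeWord v.length w = v) ∧
        ∑ v ∈ W, (q ^ v.length)⁻¹ < 1) :
    ∃ C : ℝ, 0 ≤ C ∧ ∀ u n, ((takeWord n '' followers S u).ncard : ℝ) ≤ C * q ^ n := by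
  -- Covers are indexed by follower sets rather than by words, so only finitely many occur and their
  -- word lengths have a common bound `M`.
  have hcov' : ∀ F ∈ Set.range (followers S), ∃ W : Finset (List A),
      (∀ w ∈ F, ∃ v ∈ W, takeWord v.length w = v) ∧ ∑ v ∈ W, (q ^ v.length)⁻¹ < 1 := by
    rintro _ ⟨u, rfl⟩
    exact hcov u
  choose! W hW hWsum using hcov'
  obtain ⟨M, hM⟩ := (hfin.image fun F => (W F).sup List.length).bddAbove
  have hM' : ∀ u, ∀ v ∈ W (followers S u), v.length ≤ M := fun u v hv =>
    (Finset.le_sup (f := List.length) hv).trans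
      (hM (Set.mem_image_of_mem _ (Set.mem_range_self u)))
  set C : ℝ := ({l : List A | l.length ≤ M}.ncard : ℝ) with hC
  have hC0 : 0 ≤ C := Nat.cast_nonneg _
  have hq0 : 0 < q := zero_lt_one.trans_le hq
  refine ⟨C, hC0, fun u n => ?_⟩
  induction n using Nat.strong_induction_on generalizing u with
  | _ n ih =>
    rcases le_or_gt n M with hn | hn
    · have h1 : (takeWord n '' followers S u).ncard ≤ {l : List A | l.length ≤ M}.ncard := by
        refine Set.ncard_le_ncard ?_ (List.finite_length_le A M)
        rintro _ ⟨w, -, rfl⟩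
        simpa using hn
      calc ((takeWord n '' followers S u).ncard : ℝ) ≤ C := Nat.cast_le.2 h1
        _ ≤ C * q ^ n := le_mul_of_one_le_right hC0 (one_le_pow₀ hq)
    · set F := followers S u with hF
      have hFm : F ∈ Set.range (followers S) := Set.mem_range_self u
      -- The empty word alone has weight `1`; excluding it makes the recursion descend to shorter
      -- prefixes.
      have hpos : ∀ v ∈ W F, 0 < v.length := by
        intro v hv
        by_contra h0
        have h1 := Finset.single_le_sum (f := fun v : List A => (q ^ v.length)⁻¹)
          (fun _ _ => by positivity) hv
        have h2 := hWsum F hFm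
        simp only [Nat.eq_zero_of_not_pos h0, pow_zero, inv_one] at h1
        linarith
      have hsub : takeWord n '' F ⊆ ⋃ v ∈ W F,
          (v ++ ·) '' (takeWord (n - v.length) '' followers S (u ++ v)) := by
        rintro _ ⟨w, hw, rfl⟩
        obtain ⟨v, hv, hvw⟩ := hW F hFm w hw
        have hvn : v.length + (n - v.length) = n := by have := hM' u v hv; omega
        refine Set.mem_biUnion hv ⟨_, ⟨fun j => w (v.length + j), ?_, rfl⟩, ?_⟩
        · rw [followers_append]
          have h3 := prependWord_takeWord v.length w
          rw [hvw] at h3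
          simpa [h3] using hw
        · have h3 := takeWord_add v.length (n - v.length) w
          rw [hvn, hvw] at h3
          exact h3.symm
      have hfin2 : (⋃ v ∈ W F,
          (v ++ ·) '' (takeWord (n - v.length) '' followers S (u ++ v))).Finite :=
        (W F).finite_toSet.biUnion fun v _ => (finite_image_takeWord _ _).image _
      calc ((takeWord n '' F).ncard : ℝ)
          ≤ ∑ v ∈ W F, (((v ++ ·) '' (takeWord (n - v.length) '' followers S (u ++ v))).ncard : ℝ)
            := by
            exact_mod_cast (Set.ncard_le_ncard hsub hfin2).trans (Finset.set_ncard_biUnion_le _ _)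
        _ ≤ ∑ v ∈ W F, C * q ^ n * (q ^ v.length)⁻¹ := by
            refine Finset.sum_le_sum fun v hv => ?_
            have h4 : (((v ++ ·) '' (takeWord (n - v.length) '' followers S (u ++ v))).ncard : ℝ)
                ≤ (takeWord (n - v.length) '' followers S (u ++ v)).ncard := by
              exact_mod_cast Set.ncard_image_le (finite_image_takeWord _ _)
            have hvn : v.length ≤ n := (hM' u v hv).trans hn.le
            refine h4.trans ((ih _ (by have := hpos v hv; omega) (u ++ v)).trans (le_of_eq ?_))
            rw [mul_assoc, pow_sub₀ _ hq0.ne' hvn]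
        _ = C * q ^ n * ∑ v ∈ W F, (q ^ v.length)⁻¹ := by rw [Finset.mul_sum]
        _ ≤ C * q ^ n := mul_le_of_le_one_right (by positivity) (hWsum F hFm).le

/-- The words of length `n` occurring in the elements of `S`. -/
def factors (S : Set (ℕ → A)) (n : ℕ) : Set (List A) :=
  {u | ∃ w ∈ S, ∃ m, u = takeWord n fun j => w (m + j)}

theorem finite_factors [Finite A] (S : Set (ℕ → A)) (n : ℕ) : (factors S n).Finite := by
  refine (List.finite_length_eq A n).subset ?_
  rintro _ ⟨w, -, m, rfl⟩
  simp

theorem ncard_factors_pos [Finite A] {S : Set (ℕ → A)} (hS : S.Nonempty) (n : ℕ) :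
    0 < (factors S n).ncard := by
  obtain ⟨w, hw⟩ := hS
  exact (Set.ncard_pos (finite_factors S n)).2 ⟨_, w, hw, 0, rfl⟩

theorem ncard_factors_add_le [Finite A] (S : Set (ℕ → A)) (m n : ℕ) :
    (factors S (m + n)).ncard ≤ (factors S m).ncard * (factors S n).ncard := by
  rw [← Set.ncard_prod]
  refine Set.ncard_le_ncard_of_injOn (fun u => (u.take m, u.drop m)) ?_ ?_
    ((finite_factors S m).prod (finite_factors S n))
  · rintro _ ⟨w, hw, p, rfl⟩
    simp only [takeWord_add, Set.mem_prod]
    refine ⟨⟨w, hw, p, ?_⟩, ⟨w, hw, p + m, ?_⟩⟩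
    · exact List.take_left' (length_takeWord _ _)
    · simpa only [add_assoc] using List.drop_left' (length_takeWord _ _)
  · intro u _ v _ h
    simp only [Prod.mk.injEq] at h
    rw [← List.take_append_drop m u, ← List.take_append_drop m v, h.1, h.2]

/-- Deleting what precedes an occurrence of a factor makes it a prefix of an element of a follower
set. -/
theorem ncard_factors_le [Finite A] {S : Set (ℕ → A)}
    (hfin : (Set.range (followers S)).Finite) {n : ℕ} {B : ℝ}
    (hB : ∀ u, ((takeWord n '' followers S u).ncard : ℝ) ≤ B) :
    ((factors S n).ncard : ℝ) ≤ (Set.range (followers S)).ncard * B := by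
  have hsub : factors S n ⊆ ⋃ F ∈ hfin.toFinset, takeWord n '' F := by
    rintro _ ⟨w, hw, m, rfl⟩
    exact Set.mem_biUnion (by simp) (Set.mem_image_of_mem _ (shift_mem_followers hw m))
  have hf : (⋃ F ∈ hfin.toFinset, takeWord n '' F).Finite :=
    hfin.toFinset.finite_toSet.biUnion fun F _ => finite_image_takeWord _ _
  calc ((factors S n).ncard : ℝ) ≤ ∑ F ∈ hfin.toFinset, ((takeWord n '' F).ncard : ℝ) := by
        exact_mod_cast (Set.ncard_le_ncard hsub hf).trans (Finset.set_ncard_biUnion_le _ _)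
    _ ≤ ∑ _F ∈ hfin.toFinset, B := by
        refine Finset.sum_le_sum fun F hF => ?_
        obtain ⟨u, rfl⟩ := (hfin.mem_toFinset).1 hF
        exact hB u
    _ = _ := by rw [Finset.sum_const, nsmul_eq_mul, Set.ncard_eq_toFinset_card _ hfin]

/-- Fekete's lemma for the number of factors. -/
theorem exists_tendsto_logb_ncard_factors [Finite A] {S : Set (ℕ → A)} (hS : S.Nonempty) {b : ℝ}
    (hb : 1 < b) :
    ∃ h : ℝ, 0 ≤ h ∧
      Tendsto (fun n : ℕ => Real.logb b (factors S n).ncard / n) atTop (𝓝 h) := by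
  have hpos : ∀ n, (0 : ℝ) < (factors S n).ncard := fun n => by
    exact_mod_cast ncard_factors_pos hS n
  have hnn : ∀ n : ℕ, 0 ≤ Real.logb b (factors S n).ncard / n := fun n => by
    refine div_nonneg (Real.logb_nonneg hb ?_) (Nat.cast_nonneg n)
    exact_mod_cast ncard_factors_pos hS n
  have hsub : Subadditive fun n => Real.logb b (factors S n).ncard := by
    intro m n
    rw [← Real.logb_mul (hpos m).ne' (hpos n).ne']
    refine Real.logb_le_logb_of_le hb (hpos _) ?_
    exact_mod_cast ncard_factors_add_le S m n
  have ht := hsub.tendsto_lim ⟨0, by rintro _ ⟨n, rfl⟩; exact hnn n⟩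
  exact ⟨_, ge_of_tendsto' ht hnn, ht⟩

end Words

/-! ### Digit expansions, kernel pieces and covers by grid cubes -/

section Geometry

open MeasureTheory

variable {d k : ℕ}

/-- The point of the unit cube with the `k`-adic expansion `w`. -/
noncomputable def digitPoint (w : ℕ → Fin d → Fin k) : EuclideanSpace ℝ (Fin d) :=
  WithLp.toLp 2 fun i => Real.ofDigits fun j => w j i

/-- The numbers whose base `k` digits are given by the coordinates of the letters of `u`. -/
def wordValue : List (Fin d → Fin k) → Fin d → ℕ
  | [], _ => 0
  | c :: u, i => c i * k ^ u.length + wordValue u i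

@[simp]
theorem digitPoint_apply (w : ℕ → Fin d → Fin k) (i : Fin d) :
    digitPoint w i = Real.ofDigits fun j => w j i := rfl

theorem isExpansion_iff {w : ℕ → Fin d → Fin k} {x : EuclideanSpace ℝ (Fin d)} :
    IsExpansion w x ↔ digitPoint w = x := by
  constructor
  · intro h
    ext i
    exact (h i).symm
  · rintro rfl i
    rfl

theorem continuous_digitPoint :
    Continuous (digitPoint : (ℕ → Fin d → Fin k) → EuclideanSpace ℝ (Fin d)) := by
  refine (PiLp.continuous_toLp 2 _).comp (continuous_pi fun i => ?_)
  exact Real.continuous_ofDigits.comp (by fun_prop)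

theorem exists_digitPoint_eq (hk : 2 ≤ k) {x : EuclideanSpace ℝ (Fin d)} (hx : x ∈ unitCube d) :
    ∃ w : ℕ → Fin d → Fin k, digitPoint w = x := by
  have h : ∀ i, ∃ a : ℕ → Fin k, Real.ofDigits a = x i := fun i => by
    obtain ⟨a, -, ha⟩ := Real.ofDigits_SurjOn (b := k) (by omega) (hx i)
    exact ⟨a, ha⟩
  choose a ha using h
  refine ⟨fun j i => a i j, ?_⟩
  ext i
  exact ha i

theorem wordValue_lt (u : List (Fin d → Fin k)) (i : Fin d) :
    wordValue u i < k ^ u.length := by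
  induction u with
  | nil => simp [wordValue]
  | cons c u ih =>
    have h : ((c i : ℕ) + 1) * k ^ u.length ≤ k * k ^ u.length :=
      Nat.mul_le_mul_right _ (c i).isLt
    simp only [wordValue, List.length_cons, pow_succ']
    linarith

theorem wordValue_injective {u v : List (Fin d → Fin k)} (hl : u.length = v.length)
    (h : ∀ i, wordValue u i = wordValue v i) : u = v := by
  induction u generalizing v with
  | nil => exact (List.length_eq_zero_iff.1 hl.symm).symm
  | cons c u ih =>
    cases v with
    | nil => simp at hl
    | cons c' v =>
      have hl' : u.length = v.length := by simpa using hl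
      have key : ∀ i, (c i : ℕ) = c' i ∧ wordValue u i = wordValue v i := by
        intro i
        have h1 := h i
        have h2 := wordValue_lt u i
        have h3 := wordValue_lt v i
        simp only [wordValue, ← hl'] at h1 h3
        have hp : 0 < k ^ u.length := by omega
        have e1 := congrArg (· / k ^ u.length) h1
        have e2 := congrArg (· % k ^ u.length) h1
        simp only [mul_comm _ (k ^ u.length), Nat.mul_add_div hp, Nat.mul_add_mod,
          Nat.div_eq_of_lt h2, Nat.div_eq_of_lt h3, Nat.mod_eq_of_lt h2, Nat.mod_eq_of_lt h3,
          add_zero] at e1 e2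
        exact ⟨e1, e2⟩
      rw [ih hl' fun i => (key i).2, funext fun i => Fin.ext (key i).1]

theorem digitPoint_prependWord (hk : 2 ≤ k) (u : List (Fin d → Fin k)) (w : ℕ → Fin d → Fin k)
    (i : Fin d) :
    (k : ℝ) ^ u.length * digitPoint (prependWord u w) i = wordValue u i + digitPoint w i := by
  have hk0 : (k : ℝ) ≠ 0 := by positivity
  induction u with
  | nil => simp [wordValue]
  | cons c u ih =>
    have h := Real.ofDigits_eq_sum_add_ofDigits (fun j => prependWord (c :: u) w j i) 1
    simp only [Finset.range_one, Finset.sum_singleton, Real.ofDigitsTerm,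
      prependWord_cons_zero, prependWord_cons_succ, zero_add, pow_one] at h
    simp only [digitPoint_apply] at ih ⊢
    rw [h]
    simp only [wordValue, List.length_cons, Nat.cast_add, Nat.cast_mul, Nat.cast_pow]
    rw [add_assoc, ← ih]
    field_simp
    ring

theorem digitPoint_mem_Icc (w : ℕ → Fin d → Fin k) (i : Fin d) :
    digitPoint w i ∈ Set.Icc (0 : ℝ) 1 :=
  ⟨Real.ofDigits_nonneg _, Real.ofDigits_le_one _⟩

/-- Prepending `u` is the affine map inverse to the rescaling of the cube of `u`. Closed cubes and
the use of all expansions make this an exact equality, also at grid boundaries. -/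
theorem followers_preimage_digitPoint (hk : 2 ≤ k) (X : Set (EuclideanSpace ℝ (Fin d)))
    (u : List (Fin d → Fin k)) :
    followers (digitPoint ⁻¹' X) u = digitPoint ⁻¹' kernelPiece k X u.length (wordValue u) := by
  have hp : (0 : ℝ) < (k : ℝ) ^ u.length := by positivity
  ext w
  constructor
  · intro hw
    refine ⟨digitPoint (prependWord u w), hw, fun i => ?_, fun i => ?_⟩
    · have h := digitPoint_prependWord hk u w i
      have h2 := digitPoint_mem_Icc w i
      rw [div_le_iff₀' hp, le_div_iff₀' hp, h]
      exact ⟨by linarith [h2.1], by linarith [h2.2]⟩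
    · rw [digitPoint_prependWord hk]
      ring
  · rintro ⟨x, hx, -, h⟩
    have : digitPoint (prependWord u w) = x := by
      ext i
      refine mul_left_cancel₀ hp.ne' ?_
      rw [digitPoint_prependWord hk, h i]
      ring
    change digitPoint (prependWord u w) ∈ X
    rwa [this]

theorem finite_range_followers (hk : 2 ≤ k) {X : Set (EuclideanSpace ℝ (Fin d))}
    (hX : (kKernel k X).Finite) :
    (Set.range (followers (A := Fin d → Fin k) (digitPoint ⁻¹' X))).Finite := by
  refine (hX.image (digitPoint ⁻¹' ·)).subset ?_
  rintro _ ⟨u, rfl⟩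
  exact ⟨_, ⟨u.length, wordValue u, wordValue_lt u, rfl⟩,
    (followers_preimage_digitPoint hk X u).symm⟩

/-- The rescaling is a smooth map, so it cannot raise the dimension. -/
theorem dimH_kernelPiece_le (X : Set (EuclideanSpace ℝ (Fin d))) (a : ℕ) (b : Fin d → ℕ) :
    dimH (kernelPiece k X a b) ≤ dimH X := by
  set f : EuclideanSpace ℝ (Fin d) → EuclideanSpace ℝ (Fin d) :=
    fun x => ((k : ℝ) ^ a) • x - WithLp.toLp 2 fun i => (b i : ℝ) with hf
  have hc : ContDiff ℝ 1 f := by fun_prop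
  have hsub : kernelPiece k X a b ⊆ f '' X := by
    rintro y ⟨x, hx, -, h⟩
    refine ⟨x, hx, ?_⟩
    ext i
    simp [hf, h i]
  exact (dimH_mono hsub).trans
    (hc.contDiffOn.dimH_image_le (s := Set.univ) convex_univ (Set.subset_univ X))

/-- A set whose diameter is at most the side of the grid cubes of level `m` meets few of them. -/
theorem ncard_takeWord_image_le (hk : 2 ≤ k) (m : ℕ) {T : Set (EuclideanSpace ℝ (Fin d))}
    (hT : ∀ x ∈ T, ∀ y ∈ T, dist x y ≤ ((k : ℝ) ^ m)⁻¹) :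
    (takeWord (A := Fin d → Fin k) m '' (digitPoint ⁻¹' T)).ncard ≤ 5 ^ d := by
  rcases (digitPoint (k := k) ⁻¹' T).eq_empty_or_nonempty with he | ⟨w₀, hw₀⟩
  · simp [he]
  have hp : (0 : ℝ) < (k : ℝ) ^ m := by positivity
  -- In each coordinate, `wordValue` is `k ^ m` times the point minus a tail in `[0, 1]`. The scaled
  -- points differ by at most `1` and the tails by at most `1`, leaving five integers.
  set B : Finset (Fin d → ℤ) := Fintype.piFinset fun i =>
    Finset.Icc ((wordValue (takeWord m w₀) i : ℤ) - 2) (wordValue (takeWord m w₀) i + 2) with hB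
  have hcard : B.card = 5 ^ d := by
    have h5 : ∀ z : ℤ, (z + 2 + 1 - (z - 2)).toNat = 5 := fun z => by
      rw [show z + 2 + 1 - (z - 2) = 5 by ring]; rfl
    simp [hB, Fintype.card_piFinset, h5]
  have hval : ∀ w : ℕ → Fin d → Fin k, ∀ i,
      (wordValue (takeWord m w) i : ℝ) =
        (k : ℝ) ^ m * digitPoint w i - digitPoint (fun j => w (m + j)) i := by
    intro w i
    have h := digitPoint_prependWord hk (takeWord m w) (fun j => w (m + j)) i
    rw [prependWord_takeWord, length_takeWord] at h
    rw [h]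
    ring
  rw [← hcard, ← Set.ncard_coe_finset]
  refine Set.ncard_le_ncard_of_injOn (fun u i => (wordValue u i : ℤ)) ?_ ?_ B.finite_toSet
  · rintro _ ⟨w, hw, rfl⟩
    simp only [hB, Finset.mem_coe, Fintype.mem_piFinset, Finset.mem_Icc]
    intro i
    have h1 : |digitPoint w i - digitPoint w₀ i| ≤ ((k : ℝ) ^ m)⁻¹ := by
      have h2 := PiLp.norm_apply_le (digitPoint w - digitPoint w₀) i
      rw [← dist_eq_norm] at h2
      exact h2.trans (hT _ hw _ hw₀)
    have h3 : |(k : ℝ) ^ m * (digitPoint w i - digitPoint w₀ i)| ≤ 1 := by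
      rw [abs_mul, abs_of_pos hp]
      calc _ ≤ (k : ℝ) ^ m * ((k : ℝ) ^ m)⁻¹ := by gcongr
        _ = 1 := mul_inv_cancel₀ hp.ne'
    have h4 := digitPoint_mem_Icc (fun j => w (m + j)) i
    have h5 := digitPoint_mem_Icc (fun j => w₀ (m + j)) i
    have e1 := hval w i
    have e2 := hval w₀ i
    rw [abs_le, mul_sub] at h3
    constructor
    · have : (wordValue (takeWord m w₀) i : ℝ) - 2 ≤ wordValue (takeWord m w) i := by
        linarith [h4.1, h4.2, h5.1, h5.2, h3.1, h3.2]
      exact_mod_cast this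
    · have : (wordValue (takeWord m w) i : ℝ) ≤ wordValue (takeWord m w₀) i + 2 := by
        linarith [h4.1, h4.2, h5.1, h5.2, h3.1, h3.2]
      exact_mod_cast this
  · rintro _ ⟨w, -, rfl⟩ _ ⟨w', -, rfl⟩ h
    refine wordValue_injective (by simp) fun i => ?_
    exact Int.natCast_inj.1 (congrFun h i)

theorem sum_biUnion_le {ι β : Type*} [DecidableEq ι] [DecidableEq β] (J : Finset ι)
    (V : ι → Finset β) {f : β → ℝ} (hf : ∀ v, 0 ≤ f v) :
    ∑ v ∈ J.biUnion V, f v ≤ ∑ n ∈ J, ∑ v ∈ V n, f v := by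
  induction J using Finset.induction_on with
  | empty => simp
  | insert n J hn ih =>
    rw [Finset.biUnion_insert, Finset.sum_insert hn]
    have h1 := Finset.sum_union_inter (s₁ := V n) (s₂ := J.biUnion V) (f := f)
    have h2 := Finset.sum_nonneg fun v (_ : v ∈ V n ∩ J.biUnion V) => hf v
    linarith

/-- For `x > 0`, take `m` with `b ^ (-(m + 1)) < x ≤ b ^ (-m)`. The slack `δ` is for `x = 0`, where
no level is optimal. -/
theorem exists_level {b s x δ : ℝ} (hb : 1 < b) (hs : 0 < s) (hx : 0 ≤ x) (hx1 : x ≤ 1)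
    (hδ : 0 < δ) :
    ∃ m : ℕ, x ≤ (b ^ m)⁻¹ ∧ ((b ^ s) ^ m)⁻¹ ≤ b ^ s * x ^ s + δ := by
  have hb0 : 0 < b := zero_lt_one.trans hb
  have hq : 1 < b ^ s := Real.one_lt_rpow hb hs
  rcases hx.eq_or_lt with rfl | hx
  · obtain ⟨m, hm⟩ := exists_pow_lt_of_lt_one hδ (inv_lt_one_of_one_lt₀ hq)
    refine ⟨m, by positivity, ?_⟩
    rw [← inv_pow, Real.zero_rpow hs.ne']
    linarith
  · obtain ⟨m, h1, h2⟩ := exists_nat_pow_near_of_lt_one hx hx1 (inv_pos.2 hb0)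
      (inv_lt_one_of_one_lt₀ hb)
    refine ⟨m, by rwa [← inv_pow], ?_⟩
    have h3 : ((b⁻¹ ^ (m + 1)) ^ s : ℝ) ≤ x ^ s :=
      Real.rpow_le_rpow (by positivity) h1.le hs.le
    rw [← Real.rpow_pow_comm (inv_pos.2 hb0).le, Real.inv_rpow hb0.le, pow_succ, inv_pow] at h3
    have h4 : b ^ s * (((b ^ s) ^ m)⁻¹ * (b ^ s)⁻¹) ≤ b ^ s * x ^ s := by gcongr
    have h5 : b ^ s * (((b ^ s) ^ m)⁻¹ * (b ^ s)⁻¹) = ((b ^ s) ^ m)⁻¹ := by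
      have : b ^ s ≠ 0 := by positivity
      field_simp
    linarith

/-- A closed set of expansions of the points of a null set for the `s`-dimensional Hausdorff
measure is covered by finitely many cylinders of small total `s`-weight. -/
theorem exists_finset_cylinders (hk : 2 ≤ k) {F : Set (ℕ → Fin d → Fin k)} (hF : IsClosed F)
    {s : ℝ} (hs : 0 < s) (h0 : Measure.hausdorffMeasure s (digitPoint '' F) = 0) :
    ∃ W : Finset (List (Fin d → Fin k)),
      (∀ w ∈ F, ∃ v ∈ W, takeWord v.length w = v) ∧
        ∑ v ∈ W, (((k : ℝ) ^ s) ^ v.length)⁻¹ < 1 := by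
  classical
  have hk1 : (1 : ℝ) < k := by exact_mod_cast hk
  set q : ℝ := (k : ℝ) ^ s with hq
  have hq1 : 1 < q := Real.one_lt_rpow hk1 hs
  have hq0 : 0 < q := zero_lt_one.trans hq1
  -- Chosen so that `5 ^ d * q * ε = 1 / 4`; with `c` below, the final total is `1 / 2`.
  set ε : ℝ := 1 / (4 * 5 ^ d * q) with hε
  have hε0 : 0 < ε := by positivity
  obtain ⟨t, hcov, hdiam, hsum⟩ : ∃ t : ℕ → Set (EuclideanSpace ℝ (Fin d)),
      digitPoint '' F ⊆ ⋃ n, t n ∧ (∀ n, Metric.ediam (t n) ≤ 1) ∧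
        ∑' n, ⨆ _ : (t n).Nonempty, Metric.ediam (t n) ^ s < ENNReal.ofReal ε := by
    rw [Measure.hausdorffMeasure_apply] at h0
    have h1 := (ENNReal.iSup_eq_zero.1 (ENNReal.iSup_eq_zero.1 h0 1)) one_pos
    have h2 := h1.trans_lt (ENNReal.ofReal_pos.2 hε0)
    simpa only [iInf_lt_iff, exists_prop] using h2
  set x : ℕ → ℝ := fun n => (Metric.ediam (t n)).toReal with hx
  have htop : ∀ n, Metric.ediam (t n) ≠ ⊤ := fun n =>
    ((hdiam n).trans_lt ENNReal.one_lt_top).ne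
  have hx0 : ∀ n, 0 ≤ x n := fun n => ENNReal.toReal_nonneg
  have hx1 : ∀ n, x n ≤ 1 := fun n => by
    simpa using ENNReal.toReal_mono ENNReal.one_ne_top (hdiam n)
  have hxs : ∀ J : Finset ℕ, ∑ n ∈ J, x n ^ s ≤ ε := by
    intro J
    rw [← ENNReal.ofReal_le_ofReal_iff hε0.le,
      ENNReal.ofReal_sum_of_nonneg fun n _ => Real.rpow_nonneg (hx0 n) s]
    refine le_trans (Finset.sum_le_sum fun n _ => ?_) ((ENNReal.sum_le_tsum J).trans hsum.le)
    rcases (t n).eq_empty_or_nonempty with he | hne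
    · simp [hx, he, Real.zero_rpow hs.ne']
    · rw [← ENNReal.ofReal_rpow_of_nonneg (hx0 n) hs.le, ENNReal.ofReal_toReal (htop n)]
      exact le_iSup (fun _ : (t n).Nonempty => Metric.ediam (t n) ^ s) hne
  set c : ℝ := 1 / (4 * 5 ^ d) with hc
  have hc0 : 0 < c := by positivity
  -- The slacks `c / 2 / 2 ^ n` sum to `c`.
  choose m hm1 hm2 using fun n => exists_level (δ := c / 2 / 2 ^ n) hk1 hs (hx0 n) (hx1 n)
    (by positivity)
  have hδ : ∀ J : Finset ℕ, ∑ n ∈ J, c / 2 / 2 ^ n ≤ c := fun J =>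
    sum_le_hasSum J (fun n _ => by positivity) (hasSum_geometric_two' c)
  set V : ℕ → Finset (List (Fin d → Fin k)) := fun n =>
    (finite_image_takeWord (m n) (digitPoint ⁻¹' t n)).toFinset with hV
  have hVlen : ∀ n, ∀ v ∈ V n, v.length = m n := by
    intro n v hv
    obtain ⟨w, -, rfl⟩ := (Set.Finite.mem_toFinset _).1 hv
    simp
  have hVcard : ∀ n, (V n).card ≤ 5 ^ d := by
    intro n
    rw [hV, ← Set.ncard_eq_toFinset_card _ (finite_image_takeWord _ _)]
    refine ncard_takeWord_image_le hk (m n) fun y hy z hz => le_trans ?_ (hm1 n)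
    rw [dist_edist]
    exact ENNReal.toReal_mono (htop n) (Metric.edist_le_ediam_of_mem hy hz)
  -- The sets `t n` need not be open, but the unions of cylinders replacing them are, which permits
  -- a finite subcover.
  have hopen : ∀ n, IsOpen {w : ℕ → Fin d → Fin k | takeWord (m n) w ∈ V n} := by
    intro n
    have : {w : ℕ → Fin d → Fin k | takeWord (m n) w ∈ V n} =
        ⋃ v ∈ V n, {w | takeWord (m n) w = v} := by
      ext w
      simp
    rw [this]
    exact isOpen_biUnion fun v _ => isOpen_takeWord_eq _ _
  obtain ⟨J, hJ⟩ := hF.isCompact.elim_finite_subcover _ hopen (by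
    intro w hw
    obtain ⟨n, hn⟩ := Set.mem_iUnion.1 (hcov (Set.mem_image_of_mem _ hw))
    exact Set.mem_iUnion.2 ⟨n, (Set.Finite.mem_toFinset _).2 ⟨w, hn, rfl⟩⟩)
  refine ⟨J.biUnion V, fun w hw => ?_, ?_⟩
  · obtain ⟨n, hnJ, hn⟩ := Set.mem_iUnion₂.1 (hJ hw)
    exact ⟨takeWord (m n) w, Finset.mem_biUnion.2 ⟨n, hnJ, hn⟩, by simp⟩
  · have h5 : (0 : ℝ) < 5 ^ d := by positivity
    calc ∑ v ∈ J.biUnion V, (q ^ v.length)⁻¹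
        ≤ ∑ n ∈ J, ∑ v ∈ V n, (q ^ v.length)⁻¹ :=
          sum_biUnion_le J V fun v => by positivity
      _ ≤ ∑ n ∈ J, 5 ^ d * (q * x n ^ s + c / 2 / 2 ^ n) := by
          refine Finset.sum_le_sum fun n _ => ?_
          rw [Finset.sum_congr rfl fun v hv => by rw [hVlen n v hv], Finset.sum_const,
            nsmul_eq_mul]
          have : ((V n).card : ℝ) ≤ 5 ^ d := by exact_mod_cast hVcard n
          gcongr
          exact hm2 n
      _ = 5 ^ d * (q * ∑ n ∈ J, x n ^ s + ∑ n ∈ J, c / 2 / 2 ^ n) := by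
          rw [← Finset.mul_sum, Finset.sum_add_distrib, Finset.mul_sum]
      _ ≤ 5 ^ d * (q * ε + c) := by
          gcongr
          · exact hxs J
          · exact hδ J
      _ = 1 / 2 := by
          rw [hε, hc]
          field_simp
          norm_num
      _ < 1 := by norm_num

theorem ediam_digitPoint_cylinder_le (n : ℕ) (u : List (Fin d → Fin k)) :
    Metric.ediam (digitPoint '' {w : ℕ → Fin d → Fin k | takeWord n w = u}) ≤
      ENNReal.ofReal (√d * ((k : ℝ) ^ n)⁻¹) := by
  refine Metric.ediam_le ?_
  rintro _ ⟨w, hw, rfl⟩ _ ⟨w', hw', rfl⟩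
  have hww : ∀ j < n, w j = w' j := by
    intro j hj
    have h : takeWord n w = takeWord n w' := hw.trans hw'.symm
    exact congrFun (List.ofFn_injective h) ⟨j, hj⟩
  rw [edist_dist, EuclideanSpace.dist_eq]
  refine ENNReal.ofReal_le_ofReal (Real.sqrt_le_iff.2 ⟨by positivity, ?_⟩)
  calc ∑ i, dist (digitPoint w i) (digitPoint w' i) ^ 2
      ≤ ∑ _i : Fin d, (((k : ℝ) ^ n)⁻¹) ^ 2 := by
        refine Finset.sum_le_sum fun i _ => ?_
        gcongr
        exact Real.abs_ofDigits_sub_ofDigits_le fun j hj => by rw [hww j hj]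
    _ = (√d * ((k : ℝ) ^ n)⁻¹) ^ 2 := by
        rw [mul_pow, Real.sq_sqrt (Nat.cast_nonneg d)]
        simp

end Geometry

/-! ### Comparison of Hausdorff dimension and entropy -/

section Entropy

open MeasureTheory

variable {d k : ℕ}

theorem wordCount_digitLanguage (X : Set (EuclideanSpace ℝ (Fin d))) (n : ℕ) :
    wordCount (digitLanguage k X) n =
      (factors (A := Fin d → Fin k) (digitPoint ⁻¹' X) n).ncard := by
  unfold wordCount
  congr 1
  ext u
  constructor
  · rintro ⟨⟨x, hx, w, hw, m, p, rfl⟩, hl⟩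
    rw [List.length_ofFn] at hl
    subst hl
    refine ⟨w, ?_, m, rfl⟩
    rw [Set.mem_preimage, isExpansion_iff.1 hw]
    exact hx
  · rintro ⟨w, hw, m, rfl⟩
    exact ⟨⟨_, hw, w, isExpansion_iff.2 rfl, m, n, rfl⟩, length_takeWord _ _⟩

theorem dimH_le_of_eventually_ncard_factors_le (hk : 2 ≤ k) {X : Set (EuclideanSpace ℝ (Fin d))}
    (hX : X ⊆ unitCube d) {s : NNReal}
    (hs : ∀ᶠ n : ℕ in atTop, ((factors (A := Fin d → Fin k) (digitPoint ⁻¹' X) n).ncard : ℝ) ≤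
      ((k : ℝ) ^ (s : ℝ)) ^ n) :
    dimH X ≤ s := by
  set S : Set (ℕ → Fin d → Fin k) := digitPoint ⁻¹' X with hS
  have hk1 : (1 : ℝ) < k := by exact_mod_cast hk
  have hk0 : (0 : ℝ) < k := by positivity
  set q : ℝ := (k : ℝ) ^ (s : ℝ) with hq
  have hq0 : 0 < q := Real.rpow_pos_of_pos hk0 _
  have hfin : ∀ n, Finite (factors S n) := fun n => (finite_factors S n).to_subtype
  let _ : ∀ n, Fintype (factors S n) := fun n => Fintype.ofFinite _
  set r : ℕ → ENNReal := fun n => ENNReal.ofReal (√d * ((k : ℝ) ^ n)⁻¹) with hr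
  have hr0 : Tendsto r atTop (𝓝 0) := by
    have h : Tendsto (fun n : ℕ => √d * ((k : ℝ) ^ n)⁻¹) atTop (𝓝 (√d * 0)) :=
      (tendsto_inv_atTop_zero.comp (tendsto_pow_atTop_atTop_of_one_lt hk1)).const_mul _
    rw [mul_zero] at h
    simpa only [ENNReal.ofReal_zero] using ENNReal.tendsto_ofReal h
  -- At level `n` there are at most `q ^ n` cylinders, each contributing at most `√d ^ s * q ^
  -- (-n)`; the measure is thus at most `√d ^ s`.
  refine dimH_le_of_hausdorffMeasure_ne_top (ne_top_of_le_ne_top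
    (ENNReal.ofReal_ne_top (r := √d ^ (s : ℝ))) ?_)
  refine (Measure.hausdorffMeasure_le_liminf_sum (s : ℝ) X r hr0
    (fun n (u : factors S n) => digitPoint '' {w : ℕ → Fin d → Fin k | takeWord n w = u.1})
    (.of_forall fun n u => ediam_digitPoint_cylinder_le n u.1) (.of_forall fun n x hx => ?_)).trans
    (liminf_le_of_frequently_le' (Eventually.frequently (hs.mono fun n hn => ?_)))
  · obtain ⟨w, rfl⟩ := exists_digitPoint_eq hk (hX hx)
    exact Set.mem_iUnion.2 ⟨⟨takeWord n w, w, hx, 0, by simp⟩, w, rfl, rfl⟩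
  · calc _ ≤ ∑ _u : factors S n, r n ^ (s : ℝ) :=
          Finset.sum_le_sum fun u _ =>
            ENNReal.rpow_le_rpow (ediam_digitPoint_cylinder_le n u.1) s.coe_nonneg
      _ = ENNReal.ofReal ((factors S n).ncard * (√d ^ (s : ℝ) * (q ^ n)⁻¹)) := by
          rw [Finset.sum_const, nsmul_eq_mul, Finset.card_univ, ← Nat.card_eq_fintype_card,
            Nat.card_coe_set_eq, ENNReal.ofReal_mul (Nat.cast_nonneg _),
            ENNReal.ofReal_natCast, show r n = ENNReal.ofReal (√d * ((k : ℝ) ^ n)⁻¹) from rfl,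
            ENNReal.ofReal_rpow_of_nonneg (by positivity) s.coe_nonneg,
            Real.mul_rpow (by positivity) (by positivity), Real.inv_rpow (by positivity),
            ← Real.rpow_pow_comm hk0.le]
      _ ≤ ENNReal.ofReal (√d ^ (s : ℝ)) := by
          refine ENNReal.ofReal_le_ofReal ?_
          calc _ ≤ q ^ n * (√d ^ (s : ℝ) * (q ^ n)⁻¹) := by gcongr
            _ = √d ^ (s : ℝ) := by field_simp

theorem exists_ncard_factors_le_of_dimH_lt (hk : 2 ≤ k) {X : Set (EuclideanSpace ℝ (Fin d))}
    (hX : IsSelfSimilar k X) {s : NNReal} (hs : dimH X < s) :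
    ∃ C : ℝ, ∀ n, ((factors (A := Fin d → Fin k) (digitPoint ⁻¹' X) n).ncard : ℝ) ≤
      C * ((k : ℝ) ^ (s : ℝ)) ^ n := by
  set S : Set (ℕ → Fin d → Fin k) := digitPoint ⁻¹' X with hS
  have hk1 : (1 : ℝ) < k := by exact_mod_cast hk
  have hs0 : (0 : ℝ) < s := by
    have : (0 : ENNReal) < s := zero_le.trans_lt hs
    exact_mod_cast this
  have hfin := finite_range_followers hk hX.finite_kKernel
  have hclosed : IsClosed S := hX.isCompact.isClosed.preimage continuous_digitPoint
  obtain ⟨C, -, hC⟩ := exists_ncard_prefixes_le hfin (Real.one_lt_rpow hk1 hs0).le fun u => by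
    refine exists_finset_cylinders hk (hclosed.preimage (continuous_prependWord u)) hs0 ?_
    refine hausdorffMeasure_of_dimH_lt (lt_of_le_of_lt ?_ hs)
    refine (dimH_mono ?_).trans (dimH_kernelPiece_le X u.length (wordValue u) (k := k))
    rw [Set.image_subset_iff, ← followers_preimage_digitPoint hk]
    exact subset_rfl
  refine ⟨(Set.range (followers S)).ncard * C, fun n => ?_⟩
  rw [mul_assoc]
  exact ncard_factors_le hfin fun u => hC u n

end Entropy

theorem theorem1 (d k : ℕ) (hk : 2 ≤ k) (X : Set (EuclideanSpace ℝ (Fin d)))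
    (hne : X.Nonempty) (hX : IsSelfSimilar k X) :
    ∃ h : ℝ, 0 ≤ h ∧ HasEntropy k X h ∧ dimH X = ENNReal.ofReal h := by
  have hk1 : (1 : ℝ) < k := by exact_mod_cast hk
  have hk0 : (0 : ℝ) < k := zero_lt_one.trans hk1
  have hS : (digitPoint ⁻¹' X : Set (ℕ → Fin d → Fin k)).Nonempty := by
    obtain ⟨x, hx⟩ := hne
    obtain ⟨w, rfl⟩ := exists_digitPoint_eq hk (hX.subset_unitCube hx)
    exact ⟨w, hx⟩
  obtain ⟨h, h0, hh⟩ := exists_tendsto_logb_ncard_factors hS hk1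
  have hpos : ∀ n, (0 : ℝ) < (factors (A := Fin d → Fin k) (digitPoint ⁻¹' X) n).ncard :=
    fun n => Nat.cast_pos.2 (ncard_factors_pos hS n)
  refine ⟨h, h0, ?_, le_antisymm ?_ ?_⟩
  · unfold HasEntropy
    simp only [wordCount_digitLanguage]
    refine hh.congr fun n => ?_
    ring
  · refine le_of_forall_gt_imp_ge_of_dense fun c hc => ?_
    induction c with
    | top => exact le_top
    | coe s =>
      refine dimH_le_of_eventually_ncard_factors_le hk hX.subset_unitCube ?_
      have hs : h < s := (ENNReal.ofReal_lt_coe_iff h0).1 hc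
      filter_upwards [hh.eventually_lt_const hs, eventually_gt_atTop 0] with n hn hn0
      rw [div_lt_iff₀ (Nat.cast_pos.2 hn0), Real.logb_lt_iff_lt_rpow hk1 (hpos n)] at hn
      rw [← Real.rpow_natCast, ← Real.rpow_mul hk0.le]
      exact hn.le
  · refine le_of_forall_gt_imp_ge_of_dense fun c hc => ?_
    induction c with
    | top => exact le_top
    | coe s =>
      obtain ⟨C, hC⟩ := exists_ncard_factors_le_of_dimH_lt hk hX hc
      have hC0 : 0 < C := by simpa using (hpos 0).trans_le (hC 0)
      refine ENNReal.ofReal_le_of_le_toReal ?_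
      rw [ENNReal.coe_toReal]
      -- The constant `C` disappears after division by `n`.
      have hlim : Tendsto (fun n : ℕ => Real.logb k C / n + s) atTop (𝓝 (0 + (s : ℝ))) :=
        (tendsto_const_div_atTop_nhds_zero_nat _).add_const _
      rw [zero_add] at hlim
      refine le_of_tendsto_of_tendsto hh hlim ?_
      filter_upwards [eventually_gt_atTop 0] with n hn0
      have hn : (0 : ℝ) < n := Nat.cast_pos.2 hn0
      have h1 := Real.logb_le_logb_of_le hk1 (hpos n) (hC n)
      rw [Real.logb_mul hC0.ne' (by positivity), Real.logb_pow,
        Real.logb_rpow hk0 hk1.ne'] at h1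
      rw [div_le_iff₀ hn, add_mul, div_mul_cancel₀ _ hn.ne']
      linarith
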